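/- Let $p$ be a natural number, let $a\ge 1$, and let $0<\alpha_1\le\alpha_2\le\dots\le\alpha_p$ and $0<\beta_1\le\beta_2\le\dots\le\beta_p$ be real numbers such that $$\sum_{j=1}^{k}\alpha_j\le\sum_{j=1}^{k}\beta_j\qquad\text{for every } k=1,\dots,p.$$ Let $\Gamma$ be Euler's gamma function, $\psi=\Gamma'/\Gamma$, and for $x>0$ put $$\widehat W(x)=\prod_{j=1}^{p}\frac{\Gamma(x/\alpha_j+a)^{\alpha_j}}{\Gamma(x/\beta_j+a)^{\beta_j}},\qquad \widehat V(x)=\prod_{j=1}^{p}\frac{\Gamma(x/\alpha_j+a)^{\alpha_j}\,\alpha_j^{x}}{\Gamma(x/\beta_j+a)^{\beta_j}\,\beta_j^{x}}.$$ Then the function $$(\log\widehat W)'(x)=\sum_{j=1}^{p}\bigl[\psi(x/\alpha_j+a)-\psi(x/\beta_j+a)\bigr]$$ is a Bernstein function on $(0,\infty)$, and $\widehat V$ is logarithmically completely monotonic on $(0,\infty)$. Here a function $f:(0,\infty)\to\mathbb R$ is completely monotonic if it is infinitely differentiable and $(-1)^n f^{(n)}(x)\ge 0$ for all $n\ge 0$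 and $x>0$; it is a Bernstein function if it is infinitely differentiable and nonnegative and $f'$ is completely monotonic; and a positive, infinitely differentiable $f$ is logarithmically completely monotonic if $-(\log f)'$ is completely monotonic. -/

import Mathlib

open scoped ContDiff

/-- The digamma function of a real variable, the logarithmic derivative `Γ' / Γ` of Euler's gamma
function. -/
noncomputable def realDigamma (x : ℝ) : ℝ := deriv Real.Gamma x / Real.Gamma x

/-- `f` is completely monotonic on `(0, ∞)`. -/
def IsCompletelyMonotonic (f : ℝ → ℝ) : Prop :=
  ContDiffOn ℝ ∞ f (Set.Ioi 0) ∧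
    ∀ (n : ℕ) (x : ℝ), 0 < x → 0 ≤ (-1) ^ n * iteratedDeriv n f x

/-- `f` is a Bernstein function on `(0, ∞)`: smooth, nonnegative, and
`(-1) ^ (m - 1) f^(m) ≥ 0` for all `m ≥ 1` (below `m = n + 1`), that is, `f'` is completely
monotonic. -/
def IsBernsteinFunction (f : ℝ → ℝ) : Prop :=
  ContDiffOn ℝ ∞ f (Set.Ioi 0) ∧ (∀ x : ℝ, 0 < x → 0 ≤ f x) ∧
    ∀ (n : ℕ) (x : ℝ), 0 < x → 0 ≤ (-1) ^ n * iteratedDeriv (n + 1) f x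

/-- `f` is logarithmically completely monotonic on `(0, ∞)`: it is positive and smooth there and
`-(log f)'` is completely monotonic. -/
def IsLogCompletelyMonotonic (f : ℝ → ℝ) : Prop :=
  ContDiffOn ℝ ∞ f (Set.Ioi 0) ∧ (∀ x : ℝ, 0 < x → 0 < f x) ∧
    IsCompletelyMonotonic (fun x => -deriv (fun y => Real.log (f y)) x)

/-- The ratio `∏ⱼ Γ(x/αⱼ + a)^αⱼ / Γ(x/βⱼ + a)^βⱼ`. -/
noncomputable def gammaRatioW {p : ℕ} (α β : Fin p → ℝ) (a x : ℝ) : ℝ :=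
  ∏ j, Real.Gamma (x / α j + a) ^ α j / Real.Gamma (x / β j + a) ^ β j

/-- The ratio `∏ⱼ (Γ(x/αⱼ + a)^αⱼ αⱼ^x) / (Γ(x/βⱼ + a)^βⱼ βⱼ^x)`. -/
noncomputable def gammaRatioV {p : ℕ} (α β : Fin p → ℝ) (a x : ℝ) : ℝ :=
  ∏ j, (Real.Gamma (x / α j + a) ^ α j * α j ^ x) / (Real.Gamma (x / β j + a) ^ β j * β j ^ x)

/-! Since `ψ'(x) = ∑ 1/(x+n)² = ∫₀^∞ t e^(-xt)/(1 - e^(-t)) dt`, rescaling `t` makes the derivative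
of `ψ(x/c + a)` the Laplace transform of `t ↦ h(ct)`, with `h` = `shiftedBernoulliKernel a`
(`hasDerivAt_realDigamma_div_add`). So `(log W)''` is the Laplace transform of `∑ (h(αⱼt) -
h(βⱼt))`. For `a ≥ 1`, `h` is nonincreasing and convex, so this density is nonnegative by Tomić–Weyl
(`sum_le_sum_of_convexOn_antitoneOn`), and `(log W)''` is completely monotonic
(`isCompletelyMonotonic_laplace`).

Two limits finish the proof. At `0⁺` every digamma term tends to `ψ(a)`, so `(log W)'` increases
from `0` and is Bernstein. At infinity `ψ(y) - log y → 0`, so `(log W)'` increases to `L = -∑ (log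
αⱼ - log βⱼ)`, and `-(log V)' = L - (log W)'`. -/

/-! ### Monotonicity and convexity of the kernel -/

section Kernel

open Real Set

/-- The function `u / (e ^ u - 1)`, the generating function of the Bernoulli numbers. -/
noncomputable def bernoulliKernel (u : ℝ) : ℝ := u / (exp u - 1)

/-- The function `u e ^ (-a u) / (1 - e ^ (-u))`, whose Laplace transform is the trigamma function
shifted by `a`. -/
noncomputable def shiftedBernoulliKernel (a u : ℝ) : ℝ :=
  bernoulliKernel u * exp (-((a - 1) * u))

lemma exp_sub_one_pos {u : ℝ} (hu : 0 < u) : 0 < exp u - 1 := by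
  linarith [Real.one_lt_exp_iff.2 hu]

lemma bernoulliKernel_nonneg {u : ℝ} (hu : 0 < u) : 0 ≤ bernoulliKernel u :=
  div_nonneg hu.le (exp_sub_one_pos hu).le

lemma bernoulliKernel_le_one {u : ℝ} (hu : 0 < u) : bernoulliKernel u ≤ 1 := by
  rw [bernoulliKernel, div_le_one (exp_sub_one_pos hu)]
  linarith [add_one_le_exp u]

lemma hasDerivAt_bernoulliKernel {u : ℝ} (hu : 0 < u) :
    HasDerivAt bernoulliKernel ((exp u - 1 - u * exp u) / (exp u - 1) ^ 2) u := by
  have := (hasDerivAt_id u).div ((Real.hasDerivAt_exp u).sub_const 1) (exp_sub_one_pos hu).ne'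
  refine HasDerivAt.congr_deriv (f := bernoulliKernel) this ?_
  simp only [id, one_mul]

lemma deriv_bernoulliKernel {u : ℝ} (hu : 0 < u) :
    deriv bernoulliKernel u = (exp u - 1 - u * exp u) / (exp u - 1) ^ 2 :=
  (hasDerivAt_bernoulliKernel hu).deriv

lemma antitoneOn_bernoulliKernel : AntitoneOn bernoulliKernel (Ioi 0) := by
  refine antitoneOn_of_deriv_nonpos (convex_Ioi 0)
    (fun u hu => (hasDerivAt_bernoulliKernel hu).continuousAt.continuousWithinAt)
    (fun u hu => ?_) (fun u hu => ?_)
  · rw [interior_Ioi] at hu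
    exact (hasDerivAt_bernoulliKernel hu).differentiableAt.differentiableWithinAt
  · rw [interior_Ioi] at hu
    rw [deriv_bernoulliKernel hu]
    refine div_nonpos_of_nonpos_of_nonneg ?_ (sq_nonneg _)
    have h1 : exp u * (-u + 1) ≤ exp u * exp (-u) :=
      mul_le_mul_of_nonneg_left (add_one_le_exp (-u)) (exp_pos u).le
    rw [← exp_add, add_neg_cancel, exp_zero] at h1
    linarith

/-- The factor that decides the sign of the second derivative of `bernoulliKernel`. It vanishes at
`0`, and its derivative is nonnegative because `1 - v ≤ e^(-v)`. -/
lemma sub_two_mul_exp_add_nonneg {u : ℝ} (hu : 0 ≤ u) : 0 ≤ (u - 2) * exp u + u + 2 := by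
  have hd : ∀ v : ℝ, HasDerivAt (fun v => (v - 2) * exp v + v + 2) ((v - 1) * exp v + 1) v := by
    intro v
    have := ((((hasDerivAt_id v).sub_const 2).mul (Real.hasDerivAt_exp v)).add
      (hasDerivAt_id v)).add_const 2
    refine this.congr_deriv ?_
    simp only [id]
    ring
  have hm : Monotone (fun v : ℝ => (v - 2) * exp v + v + 2) := by
    refine monotone_of_hasDerivAt_nonneg hd fun v => ?_
    have h1 : exp v * (-v + 1) ≤ exp v * exp (-v) :=
      mul_le_mul_of_nonneg_left (add_one_le_exp (-v)) (exp_pos v).le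
    rw [← exp_add, add_neg_cancel, exp_zero] at h1
    simp only [Pi.zero_apply]
    linarith
  have := hm hu
  simpa using this

lemma convexOn_bernoulliKernel : ConvexOn ℝ (Ioi 0) bernoulliKernel := by
  have hd : ∀ u ∈ Ioi (0 : ℝ), HasDerivAt (fun u => (exp u - 1 - u * exp u) / (exp u - 1) ^ 2)
      (exp u * ((u - 2) * exp u + u + 2) / (exp u - 1) ^ 3) u := by
    intro u hu
    have hpos := (exp_sub_one_pos hu).ne'
    have := ((((Real.hasDerivAt_exp u).sub_const 1)).sub
      ((hasDerivAt_id u).mul (Real.hasDerivAt_exp u))).div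
      (((Real.hasDerivAt_exp u).sub_const 1).pow 2) (pow_ne_zero 2 hpos)
    refine this.congr_deriv ?_
    simp only [Pi.sub_apply, Pi.mul_apply, Pi.pow_apply, id]
    field_simp
    ring
  refine MonotoneOn.convexOn_of_deriv (convex_Ioi 0)
    (fun u hu => (hasDerivAt_bernoulliKernel hu).continuousAt.continuousWithinAt)
    (fun u hu => ?_) ?_
  · rw [interior_Ioi] at hu
    exact (hasDerivAt_bernoulliKernel hu).differentiableAt.differentiableWithinAt
  · rw [interior_Ioi]
    refine MonotoneOn.congr (f₁ := fun u => (exp u - 1 - u * exp u) / (exp u - 1) ^ 2) ?_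
      (fun u hu => (deriv_bernoulliKernel hu).symm)
    refine monotoneOn_of_deriv_nonneg (convex_Ioi 0)
      (fun u hu => (hd u hu).continuousAt.continuousWithinAt) (fun u hu => ?_) (fun u hu => ?_)
    · rw [interior_Ioi] at hu
      exact (hd u hu).differentiableAt.differentiableWithinAt
    · rw [interior_Ioi] at hu
      rw [(hd u hu).deriv]
      exact div_nonneg (mul_nonneg (exp_pos u).le (sub_two_mul_exp_add_nonneg (le_of_lt hu)))
        (pow_nonneg (exp_sub_one_pos hu).le 3)

variable {a : ℝ}

lemma measurable_shiftedBernoulliKernel (a : ℝ) : Measurable (shiftedBernoulliKernel a) := by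
  unfold shiftedBernoulliKernel bernoulliKernel
  fun_prop

lemma shiftedBernoulliKernel_nonneg (a : ℝ) {u : ℝ} (hu : 0 < u) :
    0 ≤ shiftedBernoulliKernel a u :=
  mul_nonneg (bernoulliKernel_nonneg hu) (exp_pos _).le

lemma shiftedBernoulliKernel_le_one (ha : 1 ≤ a) {u : ℝ} (hu : 0 < u) :
    shiftedBernoulliKernel a u ≤ 1 :=
  mul_le_one₀ (bernoulliKernel_le_one hu) (exp_pos _).le
    (exp_le_one_iff.2 (neg_nonpos.2 (mul_nonneg (sub_nonneg.2 ha) hu.le)))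

lemma antitone_exp_neg_mul {c : ℝ} (hc : 0 ≤ c) : Antitone fun u : ℝ => exp (-(c * u)) :=
  fun _ _ h => exp_le_exp.2 (neg_le_neg (mul_le_mul_of_nonneg_left h hc))

lemma antitoneOn_shiftedBernoulliKernel (ha : 1 ≤ a) :
    AntitoneOn (shiftedBernoulliKernel a) (Ioi 0) :=
  fun _ hu _ hv h => mul_le_mul (antitoneOn_bernoulliKernel hu hv h)
    (antitone_exp_neg_mul (sub_nonneg.2 ha) h) (exp_pos _).le (bernoulliKernel_nonneg hu)

lemma convexOn_shiftedBernoulliKernel (ha : 1 ≤ a) :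
    ConvexOn ℝ (Ioi 0) (shiftedBernoulliKernel a) := by
  have he : ConvexOn ℝ (Ioi 0) (fun u : ℝ => exp (-((a - 1) * u))) := by
    have := (convexOn_exp.comp_linearMap (LinearMap.mulLeft ℝ (-(a - 1)))).subset
      (subset_univ _) (convex_Ioi (0 : ℝ))
    refine this.congr fun u _ => ?_
    simp only [Function.comp, LinearMap.mulLeft_apply, neg_mul]
  -- A product of nonnegative convex functions is convex when both vary in the same direction; here
  -- both decrease.
  exact convexOn_bernoulliKernel.mul he (fun u hu => bernoulliKernel_nonneg hu)
    (fun u _ => (exp_pos _).le)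
    (antitoneOn_bernoulliKernel.monovaryOn ((antitone_exp_neg_mul (sub_nonneg.2 ha)).antitoneOn _))

lemma differentiableAt_shiftedBernoulliKernel (a : ℝ) {u : ℝ} (hu : 0 < u) :
    DifferentiableAt ℝ (shiftedBernoulliKernel a) u :=
  (hasDerivAt_bernoulliKernel hu).differentiableAt.mul (by fun_prop)

end Kernel

/-! ### Summation by parts and weak majorization -/

section Majorization

open Finset

/-- Summation by parts: a sum with nonincreasing weights whose factors have nonnegative partial
sums is at least the last weight times the full sum. -/
lemma mul_sum_le_sum_mul_of_antitone {n : ℕ} (w d : Fin (n + 1) → ℝ) (hw : Antitone w)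
    (hd : ∀ k, 0 ≤ ∑ j ∈ Iic k, d j) : w (Fin.last n) * ∑ j, d j ≤ ∑ j, w j * d j := by
  induction n with
  | zero => simp
  | succ n ih =>
    have h1 := ih (fun j => w j.castSucc) (fun j => d j.castSucc)
      (fun i j h => hw (Fin.castSucc_le_castSucc_iff.2 h))
      (fun k => by simpa only [Fin.sum_Iic_castSucc] using hd k.castSucc)
    have h2 : 0 ≤ ∑ j : Fin (n + 1), d j.castSucc := by
      have := hd (Fin.last n).castSucc
      rw [Fin.sum_Iic_castSucc] at this
      rwa [show Iic (Fin.last n) = univ from Iic_top] at this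
    have h3 : w (Fin.last (n + 1)) ≤ w (Fin.last n).castSucc := hw (Fin.le_last _)
    rw [Fin.sum_univ_castSucc, Fin.sum_univ_castSucc (f := fun j => w j * d j)]
    linarith [mul_le_mul_of_nonneg_right h3 h2, h1]

lemma sum_mul_nonneg_of_antitone {p : ℕ} (w d : Fin p → ℝ) (hw : Antitone w) (hw0 : ∀ j, 0 ≤ w j)
    (hd : ∀ k, 0 ≤ ∑ j ∈ Iic k, d j) : 0 ≤ ∑ j, w j * d j := by
  cases p with
  | zero => simp
  | succ n =>
    refine le_trans (mul_nonneg (hw0 (Fin.last n)) ?_) (mul_sum_le_sum_mul_of_antitone w d hw hd)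
    simpa [show Iic (Fin.last n) = univ from Iic_top] using hd (Fin.last n)

lemma ConvexOn.deriv_mul_sub_le {s : Set ℝ} {f : ℝ → ℝ} (hf : ConvexOn ℝ s f) {x y : ℝ}
    (hx : x ∈ s) (hy : y ∈ s) (hd : DifferentiableAt ℝ f x) :
    deriv f x * (y - x) ≤ f y - f x := by
  rcases lt_trichotomy x y with h | rfl | h
  · have := hf.deriv_le_slope hx hy h hd
    rwa [slope_def_field, le_div_iff₀ (sub_pos.2 h)] at this
  · simp
  · have := hf.slope_le_deriv hy hx h hd
    rw [slope_def_field, div_le_iff₀ (sub_pos.2 h)] at this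
    linarith

/-- The Tomić–Weyl inequality for weak supermajorization. -/
lemma sum_le_sum_of_convexOn_antitoneOn {p : ℕ} {f : ℝ → ℝ} {s : Set ℝ} (hs : IsOpen s)
    (hf : ConvexOn ℝ s f) (hanti : AntitoneOn f s) (hdiff : ∀ x ∈ s, DifferentiableAt ℝ f x)
    {α β : Fin p → ℝ} (hα : ∀ j, α j ∈ s) (hβ : ∀ j, β j ∈ s) (hβmono : Monotone β)
    (hsum : ∀ k, ∑ j ∈ Iic k, α j ≤ ∑ j ∈ Iic k, β j) :
    ∑ j, f (β j) ≤ ∑ j, f (α j) := by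
  have hd : ∀ x ∈ s, deriv f x ≤ 0 := fun x hx => by
    rw [← derivWithin_of_isOpen hs hx]
    exact hanti.derivWithin_nonpos
  -- The weights `-f'(βⱼ)` are nonnegative, and nonincreasing because `f'` and `β` are monotone. The
  -- tangent lines at `βⱼ` then give `h2`.
  have h1 : 0 ≤ ∑ j, -deriv f (β j) * (β j - α j) :=
    sum_mul_nonneg_of_antitone _ _
      (fun i j h => neg_le_neg (hf.monotoneOn_deriv hdiff (hβ i) (hβ j) (hβmono h)))
      (fun j => neg_nonneg.2 (hd _ (hβ j)))
      (fun k => by rw [sum_sub_distrib]; exact sub_nonneg.2 (hsum k))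
  have h2 : ∑ j, -deriv f (β j) * (β j - α j) ≤ ∑ j, (f (α j) - f (β j)) :=
    sum_le_sum fun j _ => by
      linarith [hf.deriv_mul_sub_le (hβ j) (hα j) (hdiff _ (hβ j))]
  rw [sum_sub_distrib] at h2
  linarith

end Majorization

/-! ### Laplace transforms -/

section Laplace

open Real Set MeasureTheory ProbabilityTheory

lemma integrableOn_mul_exp_neg_mul {g : ℝ → ℝ} (hg : Measurable g) {C : ℝ}
    (hgC : ∀ t, 0 < t → |g t| ≤ C) {x : ℝ} (hx : 0 < x) :
    IntegrableOn (fun t => g t * exp (-(x * t))) (Ioi 0) := by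
  have h1 : IntegrableOn (fun t => exp (-x * t)) (Ioi 0) := integrableOn_exp_mul_Ioi (by linarith) 0
  refine Integrable.mono' (h1.const_mul C)
    (hg.mul (by fun_prop)).aestronglyMeasurable ?_
  filter_upwards [ae_restrict_mem measurableSet_Ioi] with t ht
  rw [norm_mul, norm_eq_abs, norm_of_nonneg (exp_pos _).le, neg_mul]
  exact mul_le_mul_of_nonneg_right (hgC t ht) (exp_pos _).le

/-- The Laplace transform of a bounded nonnegative function is completely monotonic. -/
lemma isCompletelyMonotonic_laplace {g : ℝ → ℝ} (hg : Measurable g) {C : ℝ}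
    (hg0 : ∀ t, 0 < t → 0 ≤ g t) (hgC : ∀ t, 0 < t → g t ≤ C) :
    IsCompletelyMonotonic (fun x => ∫ t in Ioi 0, g t * exp (-(x * t))) := by
  -- The transform is the moment generating function of `-t` under `g(t) dt`, which supplies
  -- analyticity and the derivatives; the signs combine as `(-1)ⁿ(-t)ⁿ = tⁿ`.
  set ν : Measure ℝ := volume.restrict (Ioi 0)
  set μ : Measure ℝ := ν.withDensity fun t => ENNReal.ofReal (g t)
  have hm : Measurable fun t => ENNReal.ofReal (g t) := hg.ennreal_ofReal
  have htop : ∀ᵐ t ∂ν, ENNReal.ofReal (g t) < ⊤ := by simp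
  have hpos : ∀ᵐ t ∂ν, 0 < t := ae_restrict_mem measurableSet_Ioi
  have hL : (fun x => ∫ t in Ioi 0, g t * exp (-(x * t))) = mgf (fun t => -t) μ := by
    ext x
    rw [mgf, integral_withDensity_eq_integral_toReal_smul hm htop]
    refine integral_congr_ae ?_
    filter_upwards [hpos] with t ht
    rw [ENNReal.toReal_ofReal (hg0 t ht), smul_eq_mul, mul_neg]
  have hset : Ioi 0 ⊆ interior (integrableExpSet (fun t => -t) μ) := by
    refine interior_maximal (fun x hx => ?_) isOpen_Ioi
    rw [integrableExpSet, mem_ofPred_eq, integrable_withDensity_iff_integrable_smul' hm htop]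
    refine Integrable.congr (integrableOn_mul_exp_neg_mul hg (C := C)
      (fun t ht => by rw [abs_of_nonneg (hg0 t ht)]; exact hgC t ht) hx) ?_
    filter_upwards [hpos] with t ht
    rw [ENNReal.toReal_ofReal (hg0 t ht), smul_eq_mul, mul_neg]
  rw [hL]
  refine ⟨((analyticOn_mgf.mono hset).contDiffOn (uniqueDiffOn_Ioi 0)), fun n x hx => ?_⟩
  rw [iteratedDeriv_mgf (hset hx), ← integral_const_mul]
  refine integral_nonneg_of_ae ?_
  filter_upwards [(withDensity_absolutelyContinuous ν _).ae_le hpos] with t ht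
  rw [Pi.zero_apply, ← mul_assoc, ← mul_pow, neg_one_mul, neg_neg]
  exact mul_nonneg (pow_nonneg ht.le n) (exp_pos _).le

end Laplace

/-! ### Asymptotics, series and integral for the digamma function -/

section Digamma

open Real Set Filter Topology MeasureTheory

lemma differentiableAt_Gamma_of_pos {x : ℝ} (hx : 0 < x) : DifferentiableAt ℝ Gamma x :=
  differentiableAt_Gamma fun m => by
    have : (0 : ℝ) ≤ m := m.cast_nonneg
    linarith

lemma hasDerivAt_log_Gamma {x : ℝ} (hx : 0 < x) :
    HasDerivAt (fun y => log (Gamma y)) (realDigamma x) x :=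
  (differentiableAt_Gamma_of_pos hx).hasDerivAt.log (Gamma_pos_of_pos hx).ne'

lemma log_Gamma_add_one {x : ℝ} (hx : 0 < x) : log (Gamma (x + 1)) = log x + log (Gamma x) := by
  rw [Gamma_add_one hx.ne', log_mul hx.ne' (Gamma_pos_of_pos hx).ne']

lemma realDigamma_add_one {x : ℝ} (hx : 0 < x) : realDigamma (x + 1) = realDigamma x + 1 / x := by
  have h1 : HasDerivAt (fun y => log (Gamma (y + 1))) (realDigamma (x + 1)) x :=
    (hasDerivAt_log_Gamma (by linarith : 0 < x + 1)).comp_add_const x 1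
  have h2 : HasDerivAt (fun y => log y + log (Gamma y)) (x⁻¹ + realDigamma x) x :=
    (hasDerivAt_log hx.ne').add (hasDerivAt_log_Gamma hx)
  have h3 := h2.congr_of_eventuallyEq
    (f₁ := fun y => log (Gamma (y + 1))) (by
      filter_upwards [Ioi_mem_nhds hx] with y hy using log_Gamma_add_one hy)
  rw [h1.unique h3, one_div, add_comm]

lemma realDigamma_add_nat {x : ℝ} (hx : 0 < x) (N : ℕ) :
    realDigamma (x + N) = realDigamma x + ∑ n ∈ Finset.range N, 1 / (x + n) := by
  induction N with
  | zero => simp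
  | succ N ih =>
    rw [Finset.sum_range_succ, ← add_assoc, ← ih, Nat.cast_succ, ← add_assoc,
      realDigamma_add_one (by positivity)]

/-- By convexity of `log Γ`, its slope at `x` is at most that of the chord over `[x, x + 1]`, which
is `log x`. The lower bound below uses the slope at `x + 1`. -/
lemma realDigamma_le_log {x : ℝ} (hx : 0 < x) : realDigamma x ≤ log x := by
  have := convexOn_log_Gamma.le_slope_of_hasDerivAt (mem_Ioi.2 hx)
    (mem_Ioi.2 (by linarith : 0 < x + 1)) (by linarith) (hasDerivAt_log_Gamma hx)
  rw [slope_def_field] at this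
  simpa [log_Gamma_add_one hx] using this

lemma log_sub_inv_le_realDigamma {x : ℝ} (hx : 0 < x) : log x - 1 / x ≤ realDigamma x := by
  have := convexOn_log_Gamma.slope_le_of_hasDerivAt (mem_Ioi.2 hx)
    (mem_Ioi.2 (by linarith : 0 < x + 1)) (by linarith)
    (hasDerivAt_log_Gamma (by linarith : 0 < x + 1))
  rw [slope_def_field, realDigamma_add_one hx] at this
  simp [log_Gamma_add_one hx] at this
  rw [one_div]
  linarith

lemma tendsto_realDigamma_sub_log : Tendsto (fun x => realDigamma x - log x) atTop (𝓝 0) := by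
  have h : Tendsto (fun x : ℝ => -(1 / x)) atTop (𝓝 0) := by
    simpa using (tendsto_inv_atTop_zero (𝕜 := ℝ)).neg
  refine tendsto_of_tendsto_of_tendsto_of_le_of_le' h tendsto_const_nhds ?_ ?_
  · filter_upwards [eventually_gt_atTop 0] with x hx
    linarith [log_sub_inv_le_realDigamma hx]
  · filter_upwards [eventually_gt_atTop 0] with x hx
    linarith [realDigamma_le_log hx]

lemma tendsto_realDigamma_add_sub_log (c : ℝ) :
    Tendsto (fun x => realDigamma (x + c) - log x) atTop (𝓝 0) := by
  have := (tendsto_realDigamma_sub_log.comp (tendsto_atTop_add_const_right atTop c tendsto_id)).add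
    (tendsto_log_comp_add_sub_log c)
  rw [add_zero] at this
  refine this.congr fun x => ?_
  simp

lemma hasDerivAt_inv_add {x : ℝ} (c : ℝ) (n : ℕ) (hx : 0 < x) :
    HasDerivAt (fun y : ℝ => c - 1 / (y + n)) (1 / (x + n) ^ 2) x := by
  have hne : x + n ≠ 0 := by positivity
  have := (((hasDerivAt_id x).add_const (n : ℝ)).inv hne).const_sub c
  simpa [one_div, neg_div] using this

lemma summable_one_div_add_sq {x : ℝ} (hx : 0 < x) : Summable fun n : ℕ => 1 / (x + n) ^ 2 := by
  refine ((summable_one_div_nat_add_rpow x 2).2 (by norm_num)).congr fun n => ?_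
  rw [abs_of_pos (by positivity), add_comm]
  norm_cast

/-- Partial sums telescope to `ψ(N + 1) - ψ(N + x) + ψ(x) - ψ(1)`, and both `N`-terms are asymptotic
to `log N`. -/
lemma tsum_eq_realDigamma_sub {x : ℝ} (hx : 0 < x)
    (hs : Summable fun n : ℕ => (1 / (1 + n) - 1 / (x + n) : ℝ)) :
    ∑' n : ℕ, (1 / (1 + n) - 1 / (x + n) : ℝ) = realDigamma x - realDigamma 1 := by
  have h1 := hs.hasSum.tendsto_sum_nat
  have h2 : Tendsto (fun N : ℕ => (realDigamma ((N : ℝ) + 1) - log N) -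
      (realDigamma ((N : ℝ) + x) - log N) + (realDigamma x - realDigamma 1)) atTop
      (𝓝 (0 - 0 + (realDigamma x - realDigamma 1))) :=
    (((tendsto_realDigamma_add_sub_log 1).comp tendsto_natCast_atTop_atTop).sub
      ((tendsto_realDigamma_add_sub_log x).comp tendsto_natCast_atTop_atTop)).add_const _
  rw [sub_zero, zero_add] at h2
  refine tendsto_nhds_unique h1 (h2.congr fun N => ?_)
  rw [add_comm (N : ℝ) 1, add_comm (N : ℝ) x, realDigamma_add_nat one_pos,
    realDigamma_add_nat hx, Finset.sum_sub_distrib]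
  ring

lemma hasDerivAt_realDigamma_tsum {x : ℝ} (hx : 0 < x) :
    HasDerivAt realDigamma (∑' n : ℕ, 1 / (x + n) ^ 2) x := by
  -- The half-line `(δ, ∞)` contains `x` and the base point `1`, where every term vanishes; the
  -- derivatives are dominated there by their values at `δ`.
  obtain ⟨δ, hδ, hδm⟩ := exists_between (lt_min hx one_pos)
  obtain ⟨hδx, hδ1⟩ := lt_min_iff.1 hδm
  have hderiv : ∀ (n : ℕ), ∀ y ∈ Ioi δ,
      HasDerivAt (fun z : ℝ => 1 / (1 + n) - 1 / (z + n)) (1 / (y + n) ^ 2) y :=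
    fun n y hy => hasDerivAt_inv_add _ n (hδ.trans hy)
  have hbound : ∀ (n : ℕ), ∀ y ∈ Ioi δ, ‖1 / (y + n) ^ 2‖ ≤ 1 / (δ + n) ^ 2 := by
    intro n y hy
    rw [norm_of_nonneg (by positivity)]
    have : δ ≤ y := le_of_lt hy
    gcongr
  have hs1 : Summable fun n : ℕ => (1 / (1 + n) - 1 / (1 + n) : ℝ) := by
    simpa only [sub_self] using summable_zero
  have hsum : ∀ y ∈ Ioi δ, Summable fun n : ℕ => (1 / (1 + n) - 1 / (y + n) : ℝ) :=
    fun y hy => summable_of_summable_hasDerivAt_of_isPreconnected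
      (g := fun (n : ℕ) (z : ℝ) => 1 / (1 + n) - 1 / (z + n))
      (g' := fun (n : ℕ) (z : ℝ) => 1 / (z + n) ^ 2) (y₀ := 1) (t := Ioi δ) (y := y)
      (summable_one_div_add_sq hδ) isOpen_Ioi isPreconnected_Ioi hderiv hbound hδ1 hs1 hy
  have h := (hasDerivAt_tsum_of_isPreconnected
    (g := fun (n : ℕ) (z : ℝ) => 1 / (1 + n) - 1 / (z + n))
    (g' := fun (n : ℕ) (z : ℝ) => 1 / (z + n) ^ 2) (y₀ := 1) (t := Ioi δ) (y := x)
    (summable_one_div_add_sq hδ) isOpen_Ioi isPreconnected_Ioi hderiv hbound hδ1 hs1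
    hδx).const_add (realDigamma 1)
  refine h.congr_of_eventuallyEq ?_
  filter_upwards [Ioi_mem_nhds hδx] with y hy
  rw [tsum_eq_realDigamma_sub (hδ.trans hy) (hsum y hy)]
  ring

lemma integral_mul_exp_neg_mul {c : ℝ} (hc : 0 < c) :
    ∫ t in Ioi 0, t * exp (-(c * t)) = 1 / c ^ 2 := by
  have := integral_rpow_mul_exp_neg_mul_Ioi two_pos hc
  norm_num at this
  simpa using this

lemma integrableOn_id_mul_exp_neg_mul {c : ℝ} (hc : 0 < c) :
    IntegrableOn (fun t => t * exp (-(c * t))) (Ioi 0) := by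
  -- A non-integrable function has integral `0` by convention, contradicting the value `1 / c ^ 2`.
  by_contra h
  have h1 := integral_mul_exp_neg_mul hc
  rw [integral_undef h] at h1
  have : 0 < 1 / c ^ 2 := by positivity
  linarith

lemma hasSum_mul_exp_neg_mul {x t : ℝ} (ht : 0 < t) :
    HasSum (fun n : ℕ => t * exp (-((x + n) * t))) (shiftedBernoulliKernel x t) := by
  have hlt : exp (-t) < 1 := exp_lt_one_iff.2 (neg_neg_iff_pos.2 ht)
  have h2 := (hasSum_geometric_of_lt_one (exp_pos (-t)).le hlt).mul_left (t * exp (-(x * t)))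
  have h3 : shiftedBernoulliKernel x t = t * exp (-(x * t)) * (1 - exp (-t))⁻¹ := by
    have h3 := (exp_sub_one_pos ht).ne'
    have h4 : 1 - (exp t)⁻¹ ≠ 0 := by
      rw [← exp_neg]
      exact (sub_pos.2 hlt).ne'
    rw [shiftedBernoulliKernel, bernoulliKernel, show -((x - 1) * t) = -(x * t) + t by ring,
      exp_add, exp_neg t]
    have := (exp_pos t).ne'
    field_simp
  rw [h3]
  refine h2.congr_fun fun n => ?_
  rw [← exp_nat_mul, mul_assoc, ← exp_add]
  ring_nf

lemma tsum_one_div_add_sq {x : ℝ} (hx : 0 < x) :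
    ∑' n : ℕ, 1 / (x + n) ^ 2 = ∫ t in Ioi 0, shiftedBernoulliKernel x t := by
  have hc : ∀ n : ℕ, 0 < x + n := fun n => by positivity
  have h := hasSum_integral_of_summable_integral_norm (μ := volume.restrict (Ioi 0))
    (F := fun (n : ℕ) t => t * exp (-((x + n) * t)))
    (fun n => integrableOn_id_mul_exp_neg_mul (hc n)) (by
      refine (summable_one_div_add_sq hx).congr fun n => ?_
      rw [← integral_mul_exp_neg_mul (hc n)]
      refine setIntegral_congr_fun measurableSet_Ioi fun t ht => ?_
      exact (norm_of_nonneg (mul_nonneg (le_of_lt ht) (exp_pos _).le)).symm)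
  simp_rw [fun n : ℕ => integral_mul_exp_neg_mul (hc n)] at h
  rw [h.tsum_eq]
  exact setIntegral_congr_fun measurableSet_Ioi fun t ht => (hasSum_mul_exp_neg_mul ht).tsum_eq

lemma hasDerivAt_realDigamma_div_add {a c x : ℝ} (ha : 0 < a) (hc : 0 < c) (hx : 0 < x) :
    HasDerivAt (fun y => realDigamma (y / c + a))
      (∫ t in Ioi 0, shiftedBernoulliKernel a (c * t) * exp (-(x * t))) x := by
  have hpos : 0 < x / c + a := by positivity
  have h1 : HasDerivAt (fun y => y / c + a) (1 / c) x :=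
    ((hasDerivAt_id x).div_const c).add_const a
  have h2 := (hasDerivAt_realDigamma_tsum hpos).comp x h1
  rw [tsum_one_div_add_sq hpos] at h2
  refine h2.congr_deriv ?_
  -- The substitution `t ↦ ct` absorbs the chain-rule factor `1/c` and turns `e^(-(x/c)t)` into
  -- `e^(-xt)`.
  have h3 := integral_comp_mul_left_Ioi (shiftedBernoulliKernel (x / c + a)) 0 hc
  rw [mul_zero, smul_eq_mul] at h3
  rw [mul_comm, one_div, ← h3]
  refine setIntegral_congr_fun measurableSet_Ioi fun t _ => ?_
  simp only [shiftedBernoulliKernel]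
  rw [mul_assoc, ← exp_add]
  congr 2
  field_simp
  ring

end Digamma

/-! ### From the derivative to Bernstein and completely monotonic functions -/

section MonotoneFunctions

open Real Set Filter Topology

/-- If the derivative of `f` on `(0, ∞)` is completely monotonic, then `f` is smooth and its
derivatives of positive order alternate in sign. -/
lemma contDiffOn_and_alternating_of_hasDerivAt {f f' : ℝ → ℝ}
    (hf : ∀ x, 0 < x → HasDerivAt f (f' x) x) (hf' : IsCompletelyMonotonic f') :
    ContDiffOn ℝ ∞ f (Ioi 0) ∧
      ∀ (n : ℕ) (x : ℝ), 0 < x → 0 ≤ (-1) ^ n * iteratedDeriv (n + 1) f x := by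
  refine ⟨(contDiffOn_infty_iff_deriv_of_isOpen isOpen_Ioi).2
    ⟨fun x hx => (hf x hx).differentiableAt.differentiableWithinAt,
      hf'.1.congr fun x hx => (hf x hx).deriv⟩, fun n x hx => ?_⟩
  rw [iteratedDeriv_succ', Filter.EventuallyEq.iteratedDeriv_eq (g := f') n ?_]
  · exact hf'.2 n x hx
  · filter_upwards [Ioi_mem_nhds hx] with y hy using (hf y hy).deriv

lemma IsCompletelyMonotonic.nonneg {f : ℝ → ℝ} (hf : IsCompletelyMonotonic f) {x : ℝ}
    (hx : 0 < x) : 0 ≤ f x := by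
  simpa using hf.2 0 x hx

lemma monotoneOn_of_hasDerivAt_isCompletelyMonotonic {f f' : ℝ → ℝ}
    (hf : ∀ x, 0 < x → HasDerivAt f (f' x) x) (hf' : IsCompletelyMonotonic f') :
    MonotoneOn f (Ioi 0) := by
  refine monotoneOn_of_deriv_nonneg (convex_Ioi 0)
    (fun x hx => (hf x hx).continuousAt.continuousWithinAt) (fun x hx => ?_) (fun x hx => ?_)
  · rw [interior_Ioi] at hx
    exact (hf x hx).differentiableAt.differentiableWithinAt
  · rw [interior_Ioi] at hx
    rw [(hf x hx).deriv]
    exact hf'.nonneg hx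

lemma isBernsteinFunction_of_hasDerivAt {f f' : ℝ → ℝ}
    (hf : ∀ x, 0 < x → HasDerivAt f (f' x) x) (hf' : IsCompletelyMonotonic f')
    (h0 : Tendsto f (𝓝[>] 0) (𝓝 0)) : IsBernsteinFunction f := by
  obtain ⟨hsm, halt⟩ := contDiffOn_and_alternating_of_hasDerivAt hf hf'
  refine ⟨hsm, fun x hx => le_of_tendsto h0 ?_, halt⟩
  filter_upwards [Ioo_mem_nhdsGT hx] with y hy
  exact monotoneOn_of_hasDerivAt_isCompletelyMonotonic hf hf' hy.1 hx hy.2.le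

/-- A function with completely monotonic derivative and limit `L` at infinity is the difference of
`L` and a completely monotonic function. -/
lemma isCompletelyMonotonic_sub_of_hasDerivAt {f f' : ℝ → ℝ}
    (hf : ∀ x, 0 < x → HasDerivAt f (f' x) x) (hf' : IsCompletelyMonotonic f') {L : ℝ}
    (hL : Tendsto f atTop (𝓝 L)) : IsCompletelyMonotonic (fun x => L - f x) := by
  obtain ⟨hsm, halt⟩ := contDiffOn_and_alternating_of_hasDerivAt hf hf'
  refine ⟨contDiffOn_const.sub hsm, fun n x hx => ?_⟩
  cases n with
  | zero =>
    simp only [pow_zero, iteratedDeriv_zero, one_mul, sub_nonneg]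
    refine ge_of_tendsto hL ?_
    filter_upwards [eventually_ge_atTop x] with y hy
    exact monotoneOn_of_hasDerivAt_isCompletelyMonotonic hf hf' hx (hx.trans_le hy) hy
  | succ n =>
    rw [iteratedDeriv_const_sub n.succ_pos, iteratedDeriv_neg, pow_succ]
    linarith [halt n x hx]

lemma IsCompletelyMonotonic.congr {f g : ℝ → ℝ} (hf : IsCompletelyMonotonic f)
    (h : ∀ x, 0 < x → g x = f x) : IsCompletelyMonotonic g := by
  refine ⟨hf.1.congr h, fun n x hx => ?_⟩
  rw [Filter.EventuallyEq.iteratedDeriv_eq (g := f) n ?_]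
  · exact hf.2 n x hx
  · filter_upwards [Ioi_mem_nhds hx] with y hy using h y hy

lemma isLogCompletelyMonotonic_of_hasDerivAt {f f' : ℝ → ℝ} (hpos : ∀ x, 0 < x → 0 < f x)
    (hf : ∀ x, 0 < x → HasDerivAt (fun y => log (f y)) (-f' x) x)
    (hf' : IsCompletelyMonotonic f') : IsLogCompletelyMonotonic f := by
  have hlog : ContDiffOn ℝ ∞ (fun y => log (f y)) (Ioi 0) :=
    (contDiffOn_infty_iff_deriv_of_isOpen isOpen_Ioi).2
      ⟨fun x hx => (hf x hx).differentiableAt.differentiableWithinAt,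
        hf'.1.neg.congr fun x hx => (hf x hx).deriv⟩
  -- Smoothness of `f` is recovered from `f = exp (log f)`.
  refine ⟨hlog.exp.congr fun x hx => (exp_log (hpos x hx)).symm, hpos, hf'.congr fun x hx => ?_⟩
  rw [(hf x hx).deriv, neg_neg]

end MonotoneFunctions

/-! ### The gamma ratios -/

section GammaRatio

open Real Set Filter Topology MeasureTheory

variable {p : ℕ} {α β : Fin p → ℝ} {a : ℝ}

lemma Gamma_div_add_pos {c x : ℝ} (ha : 0 < a) (hc : 0 < c) (hx : 0 < x) :
    0 < Gamma (x / c + a) :=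
  Gamma_pos_of_pos (by positivity)

lemma gammaRatioW_pos (ha : 0 < a) (hα : ∀ j, 0 < α j) (hβ : ∀ j, 0 < β j) {x : ℝ} (hx : 0 < x) :
    0 < gammaRatioW α β a x :=
  Finset.prod_pos fun j _ => div_pos (rpow_pos_of_pos (Gamma_div_add_pos ha (hα j) hx) _)
    (rpow_pos_of_pos (Gamma_div_add_pos ha (hβ j) hx) _)

lemma log_gammaRatioW (ha : 0 < a) (hα : ∀ j, 0 < α j) (hβ : ∀ j, 0 < β j) {x : ℝ} (hx : 0 < x) :
    log (gammaRatioW α β a x) =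
      ∑ j, (α j * log (Gamma (x / α j + a)) - β j * log (Gamma (x / β j + a))) := by
  have h1 := fun j => Gamma_div_add_pos ha (hα j) hx
  have h2 := fun j => Gamma_div_add_pos ha (hβ j) hx
  rw [gammaRatioW, log_prod fun j _ =>
    (div_pos (rpow_pos_of_pos (h1 j) (α j)) (rpow_pos_of_pos (h2 j) (β j))).ne']
  refine Finset.sum_congr rfl fun j _ => ?_
  rw [log_div (rpow_pos_of_pos (h1 j) _).ne' (rpow_pos_of_pos (h2 j) _).ne', log_rpow (h1 j),
    log_rpow (h2 j)]

lemma hasDerivAt_mul_log_Gamma_div_add {c x : ℝ} (ha : 0 < a) (hc : 0 < c) (hx : 0 < x) :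
    HasDerivAt (fun y => c * log (Gamma (y / c + a))) (realDigamma (x / c + a)) x := by
  have h1 : HasDerivAt (fun y => y / c + a) (1 / c) x :=
    ((hasDerivAt_id x).div_const c).add_const a
  have h2 := ((hasDerivAt_log_Gamma (by positivity : 0 < x / c + a)).comp x h1).const_mul c
  refine h2.congr_deriv ?_
  field_simp

lemma hasDerivAt_log_gammaRatioW (ha : 0 < a) (hα : ∀ j, 0 < α j) (hβ : ∀ j, 0 < β j) {x : ℝ}
    (hx : 0 < x) : HasDerivAt (fun y => log (gammaRatioW α β a y))
      (∑ j, (realDigamma (x / α j + a) - realDigamma (x / β j + a))) x := by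
  have h := HasDerivAt.fun_sum (u := Finset.univ) fun j _ =>
    (hasDerivAt_mul_log_Gamma_div_add ha (hα j) hx).sub
      (hasDerivAt_mul_log_Gamma_div_add ha (hβ j) hx)
  refine h.congr_of_eventuallyEq ?_
  filter_upwards [Ioi_mem_nhds hx] with y hy using log_gammaRatioW ha hα hβ hy

/-- The extra exponential only adds a constant to the logarithmic derivative, the one that cancels
its limit at infinity. -/
lemma gammaRatioV_eq (hα : ∀ j, 0 < α j) (hβ : ∀ j, 0 < β j) (x : ℝ) :
    gammaRatioV α β a x = gammaRatioW α β a x * exp ((∑ j, (log (α j) - log (β j))) * x) := by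
  rw [gammaRatioV, gammaRatioW, Finset.sum_mul, exp_sum, ← Finset.prod_mul_distrib]
  refine Finset.prod_congr rfl fun j _ => ?_
  rw [sub_mul, exp_sub, ← rpow_def_of_pos (hα j), ← rpow_def_of_pos (hβ j), mul_div_mul_comm]

lemma hasDerivAt_log_gammaRatioV (ha : 0 < a) (hα : ∀ j, 0 < α j) (hβ : ∀ j, 0 < β j) {x : ℝ}
    (hx : 0 < x) : HasDerivAt (fun y => log (gammaRatioV α β a y))
      (∑ j, (realDigamma (x / α j + a) - realDigamma (x / β j + a)) +
        ∑ j, (log (α j) - log (β j))) x := by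
  have h := (hasDerivAt_log_gammaRatioW ha hα hβ hx).add
    ((hasDerivAt_id x).const_mul (∑ j, (log (α j) - log (β j))))
  rw [mul_one] at h
  refine h.congr_of_eventuallyEq ?_
  filter_upwards [Ioi_mem_nhds hx] with y hy
  rw [gammaRatioV_eq hα hβ, log_mul (gammaRatioW_pos ha hα hβ hy).ne' (exp_pos _).ne', log_exp]
  rfl

/-- The density whose Laplace transform is the second logarithmic derivative of
`gammaRatioW α β a`. -/
noncomputable def gammaRatioDensity (α β : Fin p → ℝ) (a t : ℝ) : ℝ :=
  ∑ j, (shiftedBernoulliKernel a (α j * t) - shiftedBernoulliKernel a (β j * t))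

lemma measurable_gammaRatioDensity (α β : Fin p → ℝ) (a : ℝ) :
    Measurable (gammaRatioDensity α β a) :=
  Finset.measurable_fun_sum _ fun j _ =>
    ((measurable_shiftedBernoulliKernel a).comp (measurable_const_mul (α j))).sub
      ((measurable_shiftedBernoulliKernel a).comp (measurable_const_mul (β j)))

lemma gammaRatioDensity_nonneg (ha : 1 ≤ a) (hα : ∀ j, 0 < α j) (hβ : ∀ j, 0 < β j)
    (hβmono : Monotone β)
    (hsum : ∀ k : Fin p, ∑ j ∈ Finset.Iic k, α j ≤ ∑ j ∈ Finset.Iic k, β j) {t : ℝ} (ht : 0 < t) :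
    0 ≤ gammaRatioDensity α β a t := by
  rw [gammaRatioDensity, Finset.sum_sub_distrib, sub_nonneg]
  refine sum_le_sum_of_convexOn_antitoneOn isOpen_Ioi (convexOn_shiftedBernoulliKernel ha)
    (antitoneOn_shiftedBernoulliKernel ha)
    (fun u hu => differentiableAt_shiftedBernoulliKernel a hu) (fun j => mul_pos (hα j) ht)
    (fun j => mul_pos (hβ j) ht) (fun i j h => mul_le_mul_of_nonneg_right (hβmono h) ht.le)
    (fun k => ?_)
  rw [← Finset.sum_mul, ← Finset.sum_mul]
  exact mul_le_mul_of_nonneg_right (hsum k) ht.le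

/-- Boundedness makes the Laplace integral converge for all `x > 0`. -/
lemma gammaRatioDensity_le (ha : 1 ≤ a) (hα : ∀ j, 0 < α j) (hβ : ∀ j, 0 < β j) {t : ℝ}
    (ht : 0 < t) : gammaRatioDensity α β a t ≤ p := by
  have h : gammaRatioDensity α β a t ≤ ∑ _j : Fin p, (1 : ℝ) := Finset.sum_le_sum fun j _ => by
    linarith [shiftedBernoulliKernel_le_one ha (mul_pos (hα j) ht),
      shiftedBernoulliKernel_nonneg a (mul_pos (hβ j) ht)]
  simpa using h

lemma integrableOn_shiftedBernoulliKernel_mul_exp (ha : 1 ≤ a) {c x : ℝ} (hc : 0 < c)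
    (hx : 0 < x) :
    IntegrableOn (fun t => shiftedBernoulliKernel a (c * t) * exp (-(x * t))) (Ioi 0) :=
  integrableOn_mul_exp_neg_mul (C := 1)
    ((measurable_shiftedBernoulliKernel a).comp (measurable_const_mul c))
    (fun t ht => by
      rw [Function.comp_apply, abs_of_nonneg (shiftedBernoulliKernel_nonneg a (mul_pos hc ht))]
      exact shiftedBernoulliKernel_le_one ha (mul_pos hc ht)) hx

lemma hasDerivAt_sum_realDigamma_sub (ha : 1 ≤ a) (hα : ∀ j, 0 < α j) (hβ : ∀ j, 0 < β j) {x : ℝ}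
    (hx : 0 < x) :
    HasDerivAt (fun x => ∑ j, (realDigamma (x / α j + a) - realDigamma (x / β j + a)))
      (∫ t in Ioi 0, gammaRatioDensity α β a t * exp (-(x * t))) x := by
  have ha0 : 0 < a := one_pos.trans_le ha
  have h := HasDerivAt.fun_sum (u := Finset.univ) fun j _ =>
    (hasDerivAt_realDigamma_div_add ha0 (hα j) hx).sub
      (hasDerivAt_realDigamma_div_add ha0 (hβ j) hx)
  refine h.congr_deriv ?_
  have hiα := fun j => integrableOn_shiftedBernoulliKernel_mul_exp ha (hα j) hx
  have hiβ := fun j => integrableOn_shiftedBernoulliKernel_mul_exp ha (hβ j) hx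
  simp_rw [gammaRatioDensity, Finset.sum_mul, sub_mul]
  refine Eq.trans ?_ (integral_finsetSum _ fun j _ => (hiα j).sub (hiβ j)).symm
  exact Finset.sum_congr rfl fun j _ => (integral_sub (hiα j) (hiβ j)).symm

lemma tendsto_sum_realDigamma_sub_zero (ha : 0 < a) (α β : Fin p → ℝ) :
    Tendsto (fun x => ∑ j, (realDigamma (x / α j + a) - realDigamma (x / β j + a)))
      (𝓝[>] 0) (𝓝 0) := by
  have hc : ∀ c : ℝ, Tendsto (fun x => realDigamma (x / c + a)) (𝓝 0) (𝓝 (realDigamma a)) := by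
    intro c
    have h1 : Tendsto (fun x : ℝ => x / c + a) (𝓝 0) (𝓝 a) := by
      simpa using ((tendsto_id (α := ℝ) (x := 𝓝 0)).div_const c).add_const a
    exact (hasDerivAt_realDigamma_tsum ha).continuousAt.tendsto.comp h1
  have h := tendsto_finsetSum (Finset.univ : Finset (Fin p)) fun j _ => (hc (α j)).sub (hc (β j))
  simp only [sub_self, Finset.sum_const_zero] at h
  exact h.mono_left nhdsWithin_le_nhds

lemma tendsto_realDigamma_div_add_sub_log {c : ℝ} (hc : 0 < c) (a : ℝ) :
    Tendsto (fun x => realDigamma (x / c + a) - log x) atTop (𝓝 (-log c)) := by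
  have h := ((tendsto_realDigamma_add_sub_log a).comp
    (tendsto_id.atTop_div_const hc)).sub_const (log c)
  rw [zero_sub] at h
  refine h.congr' ?_
  filter_upwards [eventually_gt_atTop 0] with x hx
  simp only [Function.comp_apply, id]
  rw [log_div hx.ne' hc.ne']
  ring

lemma tendsto_sum_realDigamma_sub_atTop (hα : ∀ j, 0 < α j) (hβ : ∀ j, 0 < β j) (a : ℝ) :
    Tendsto (fun x => ∑ j, (realDigamma (x / α j + a) - realDigamma (x / β j + a)))
      atTop (𝓝 (-∑ j, (log (α j) - log (β j)))) := by
  rw [← Finset.sum_neg_distrib]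
  refine tendsto_finsetSum _ fun j _ => ?_
  have h := (tendsto_realDigamma_div_add_sub_log (hα j) a).sub
    (tendsto_realDigamma_div_add_sub_log (hβ j) a)
  rw [show -log (α j) - -log (β j) = -(log (α j) - log (β j)) by ring] at h
  exact h.congr fun x => by ring

end GammaRatio

theorem mainTheorem7 (p : ℕ) (α β : Fin p → ℝ) (a : ℝ) (ha : 1 ≤ a)
    (hα : ∀ j, 0 < α j) (hβ : ∀ j, 0 < β j)
    (hαmono : Monotone α) (hβmono : Monotone β)
    (hsum : ∀ k : Fin p, ∑ j ∈ Finset.Iic k, α j ≤ ∑ j ∈ Finset.Iic k, β j) :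
    (∀ x : ℝ, 0 < x →
      HasDerivAt (fun y => Real.log (gammaRatioW α β a y))
        (∑ j, (realDigamma (x / α j + a) - realDigamma (x / β j + a))) x) ∧
    IsBernsteinFunction
      (fun x => ∑ j, (realDigamma (x / α j + a) - realDigamma (x / β j + a))) ∧
    IsLogCompletelyMonotonic (gammaRatioV α β a) := by
  have ha0 : 0 < a := one_pos.trans_le ha
  have hderiv := fun x (hx : 0 < x) => hasDerivAt_sum_realDigamma_sub ha hα hβ hx
  have hcm := isCompletelyMonotonic_laplace (measurable_gammaRatioDensity α β a)
    (fun t ht => gammaRatioDensity_nonneg ha hα hβ hβmono hsum ht)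
    (fun t ht => gammaRatioDensity_le ha hα hβ ht)
  refine ⟨fun x hx => hasDerivAt_log_gammaRatioW ha0 hα hβ hx,
    isBernsteinFunction_of_hasDerivAt hderiv hcm (tendsto_sum_realDigamma_sub_zero ha0 α β),
    isLogCompletelyMonotonic_of_hasDerivAt (fun x hx => ?_) (fun x hx => ?_)
      (isCompletelyMonotonic_sub_of_hasDerivAt hderiv hcm
        (tendsto_sum_realDigamma_sub_atTop hα hβ a))⟩
  · rw [gammaRatioV_eq hα hβ]
    exact mul_pos (gammaRatioW_pos ha0 hα hβ hx) (Real.exp_pos _)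
  · refine (hasDerivAt_log_gammaRatioV ha0 hα hβ hx).congr_deriv ?_
    ring
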